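/- Let $n\ge 1$ and let $I_n=\ker\phi_n\subset\mathbb{C}[x]=\mathbb{C}[x_{ab}\mid 1\le a<b\le n]$ (write $x_{ba}=x_{ab}$) be the toric ideal of the second hypersimplex, where $\phi_n:\mathbb{C}[x]\to\mathbb{C}[t_1,\dots,t_n]$, $x_{ab}\mapsto t_at_b$. For an ideal $I$ of $\mathbb{C}[x]$, the secant ideal is $$I^{\{2\}}=\bigl(I(y)+I(z)+\langle y_{ab}+z_{ab}-x_{ab}\mid a<b\rangle\bigr)\cap\mathbb{C}[x],$$ where $I(y),I(z)$ are copies of $I$ in new sets of variables $y_{ab}$, $z_{ab}$. Let $k\ge 1$. A pair of sequences $\mathbf{i}=(i_1,\dots,i_{2k+1})$, $\mathbf{j}=(j_1,\dots,j_{2k+1})$ in $\{1,\dots,n\}$ is called admissible if $$i_1\le j_1<i_2\le j_2<\cdots<i_{2k+1}\le j_{2k+1}<i_1$$ in the circular order of $1,\dots,n$, with exactly one revolution around the circle, and if, when $k=1$, moreover $i_l\ne j_l$ for all $l$. Indices $l$ of $i_l,j_l$ are read modulo $2k+1$. Regard $i_1,j_1,\dots,i_{2k+1},j_{2k+1}$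 as $4k+2$ pairwise distinct formal letters, let $\tau$ be the fixed-point-free involution $\prod_{l=1}^{2k+1}(i_l\,j_{l+k-1})$ of these letters, and let $Z_{\mathbf{i},\mathbf{j}}$ be the group of permutations of the letters generated by the $2k+1$ transpositions $(i_l\,j_{l-1})$. For $\sigma\in Z_{\mathbf{i},\mathbf{j}}$ let $\mathbf{x}^\sigma_{\mathbf{i},\mathbf{j}}\in\mathbb{C}[x]$ be the product, over the transpositions $(a\,b)$ in the cycle decomposition of $\sigma\tau\sigma^{-1}$, of the variables $x_{ab}$, each letter being replaced by the element of $\{1,\dots,n\}$ that it stands for. The master polynomial is $$f_{\mathbf{i},\mathbf{j}}=\sum_{\sigma\in Z_{\mathbf{i},\mathbf{j}}}(-1)^{\sigma}\,\mathbf{x}^{\sigma}_{\mathbf{i},\mathbf{j}},$$ where $(-1)^\sigma$ is the sign of $\sigma$. Then for every admissible pair $\mathbf{i},\mathbf{j}$ the master polynomial $f_{\mathbf{i},\mathbf{j}}$ is nonzero and belongs to the secant ideal $I_n^{\{2\}}$. -/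

import Mathlib

open scoped BigOperators

noncomputable section

namespace Hypersimplex

/-! ### Secant ideals -/

/-- The `r`-th secant ideal of an ideal `I` of `K[x_s | s ∈ σ]`, i.e. the `r`-fold join of `I` with
itself.  Work in the polynomial ring with variables `x_s` (`Sum.inl s`) and `r` further copies
`y_{a,s}` (`Sum.inr (a, s)`) of them; take the ideal
`I(y_1) + ⋯ + I(y_r) + ⟨y_{1,s} + ⋯ + y_{r,s} - x_s | s ∈ σ⟩` and eliminate all the `y_{a,s}`. -/
def secantIdeal {K σ : Type*} [Field K] (r : ℕ) (I : Ideal (MvPolynomial σ K)) :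
    Ideal (MvPolynomial σ K) :=
  Ideal.comap
    (MvPolynomial.rename (Sum.inl : σ → σ ⊕ (Fin r × σ)) :
      MvPolynomial σ K →ₐ[K] MvPolynomial (σ ⊕ (Fin r × σ)) K)
    ((⨆ a : Fin r, Ideal.map
        (MvPolynomial.rename (fun s : σ => (Sum.inr (a, s) : σ ⊕ (Fin r × σ))) :
          MvPolynomial σ K →ₐ[K] MvPolynomial (σ ⊕ (Fin r × σ)) K) I) ⊔
      Ideal.span (Set.range fun s : σ =>
        (∑ a : Fin r, MvPolynomial.X (Sum.inr (a, s))) - MvPolynomial.X (Sum.inl s)))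

/-! ### The toric ideal of the second hypersimplex -/

/-- The edges of the complete graph on `n` vertices, i.e. the unordered pairs of distinct elements
of `Fin n`; they index the variables `x_{ij} = x_{ji}`. -/
abbrev Edge (n : ℕ) : Type := {e : Sym2 (Fin n) // ¬ e.IsDiag}

/-- The ring homomorphism `φ_n : ℂ[x] → ℂ[t]`, `x_{ij} ↦ t_i t_j`. -/
def phi (n : ℕ) : MvPolynomial (Edge n) ℂ →ₐ[ℂ] MvPolynomial (Fin n) ℂ :=
  MvPolynomial.aeval fun e : Edge n =>
    (e.1.map (MvPolynomial.X : Fin n → MvPolynomial (Fin n) ℂ)).mul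

/-- The toric ideal `I_n = ker φ_n` of the second hypersimplex. -/
def toricIdeal (n : ℕ) : Ideal (MvPolynomial (Edge n) ℂ) := RingHom.ker (phi n)

/-- The variable `x_{ij}` belonging to an unordered pair of vertices.  There is no variable for a
pair `{i, i}`; the value `0` given there is a convention that is never used for the master
polynomial of an admissible pair. -/
def edgeVar {n : ℕ} (e : Sym2 (Fin n)) : MvPolynomial (Edge n) ℂ :=
  open Classical in if h : e.IsDiag then 0 else MvPolynomial.X ⟨e, h⟩

/-! ### Admissible pairs of sequences -/

/-- The number of clockwise steps from the vertex `a` to the vertex `b` on the circle of vertices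
`0, 1, …, n - 1`, i.e. the residue of `b - a` modulo `n` in `{0, …, n - 1}`. -/
def cwDist {n : ℕ} (a b : Fin n) : ℕ := (b - a).val

/-- The pair of sequences `i, j` of odd length `2k + 1 ≥ 3` is admissible if
`i_0 ≤ j_0 < i_1 ≤ j_1 < ⋯ < i_{2k} ≤ j_{2k} < i_0`
in the circular order of the vertices, making exactly one revolution around the circle.
In length three all six vertices have to be distinct. -/
structure Admissible {n k : ℕ} (i j : Fin (2 * k + 1) → Fin n) : Prop where
  one_le : 1 ≤ k
  le : ∀ l, cwDist (i 0) (i l) ≤ cwDist (i 0) (j l)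
  lt : ∀ l m, l < m → cwDist (i 0) (j l) < cwDist (i 0) (i m)
  ne_of_eq_one : k = 1 → ∀ l, i l ≠ j l

/-! ### Master polynomials -/

/-- The `4k + 2` formal letters: `Sum.inl l` stands for `i_l` and `Sum.inr l` stands for `j_l`.
They are pairwise different even if `i_l = j_l` as vertices. -/
abbrev Letter (k : ℕ) : Type := Fin (2 * k + 1) ⊕ Fin (2 * k + 1)

/-- The residue class of `k - 1` modulo `2k + 1`. -/
def shift (k : ℕ) : Fin (2 * k + 1) := Fin.ofNat (2 * k + 1) k - 1

/-- The fixed point free involution `∏_l (i_l j_{l+k-1})` on the letters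
(indices modulo `2k + 1`). -/
def cycleInvolution (k : ℕ) : Equiv.Perm (Letter k) where
  toFun := Sum.elim (fun l => Sum.inr (l + shift k)) (fun l => Sum.inl (l - shift k))
  invFun := Sum.elim (fun l => Sum.inr (l + shift k)) (fun l => Sum.inl (l - shift k))
  left_inv := by rintro (l | l) <;> simp
  right_inv := by rintro (l | l) <;> simp

/-- The group `Z` generated by the `2k + 1` transpositions `(i_l j_{l-1})`
(indices modulo `2k + 1`). -/
def outerGroup (k : ℕ) : Subgroup (Equiv.Perm (Letter k)) :=
  Subgroup.closure (Set.range fun l : Fin (2 * k + 1) => Equiv.swap (Sum.inl l) (Sum.inr (l - 1)))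

/-- The monomial of a fixed point free involution `ρ` of the letters: the product, over the
two-element orbits `{a, ρ a}`, of the variables `x_{v(a) v(ρ a)}`, where `v` sends each letter to
the vertex it stands for. -/
def involutionMonomial {n k : ℕ} (i j : Fin (2 * k + 1) → Fin n) (ρ : Equiv.Perm (Letter k)) :
    MvPolynomial (Edge n) ℂ :=
  ∏ e ∈ Finset.univ.image (fun a : Letter k => s(a, ρ a)), edgeVar (e.map (Sum.elim i j))

/-- The master polynomial
`f_{i,j} = ∑_{σ ∈ Z} (-1)^σ x^σ`, where `x^σ` is the monomial of the conjugate by `σ` of the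
involution `∏_l (i_l j_{l+k-1})`. -/
def masterPolynomial {n k : ℕ} (i j : Fin (2 * k + 1) → Fin n) : MvPolynomial (Edge n) ℂ :=
  open Classical in
  ∑ σ : outerGroup k, ((Equiv.Perm.sign (σ : Equiv.Perm (Letter k)) : ℤˣ) : ℤ) •
    involutionMonomial i j (σ * cycleInvolution k * (σ : Equiv.Perm (Letter k))⁻¹)

end Hypersimplex

end

namespace Hypersimplex

open scoped TensorProduct Fin.CommRing

/-! ### Secant ideals of kernels -/

section Secant

variable {K : Type*} [Field K]

/-! Over a field, membership in the secant ideal follows once the polynomial vanishes at `x_ab = s_a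
s_b + t_a t_b`, with `s`, `t` independent (`mem_secantIdeal_two_ker`). Expanding each monomial there
gives a sum over two-colourings of the edges of a cycle of odd length `2k + 1`. Some two adjacent
edges, joined at a block `{i_l, j_{l-1}}`, share a colour (`exists_color_eq`), and the swap of that
block, which lies in the outer group, pairs off terms of opposite sign. For nonvanishing, set the
edges of the uncojugated cycle to 1 and all others to 0: index arithmetic modulo `2k + 1` shows that
only the identity survives (`fixed_of_edge_eq`). -/

/-- The kernel of a tensor square of an algebra homomorphism over a field, without surjectivity. -/
theorem ker_tensorProduct_map {A B : Type*} [CommRing A] [Algebra K A] [CommRing B] [Algebra K B]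
    (φ : A →ₐ[K] B) :
    RingHom.ker (Algebra.TensorProduct.map φ φ) =
      (RingHom.ker φ).map (Algebra.TensorProduct.includeLeft : A →ₐ[K] A ⊗[K] A) ⊔
        (RingHom.ker φ).map (Algebra.TensorProduct.includeRight : A →ₐ[K] A ⊗[K] A) := by
  have hker : RingHom.ker φ.rangeRestrict = RingHom.ker φ := by
    ext x
    simp [RingHom.mem_ker, Subtype.ext_iff]
  have hcomp : Algebra.TensorProduct.map φ φ =
      (Algebra.TensorProduct.map φ.range.val φ.range.val).comp
        (Algebra.TensorProduct.map φ.rangeRestrict φ.rangeRestrict) := by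
    ext x <;> simp
  -- Everything is flat over a field, so the inclusion of the range stays injective after tensoring.
  have hinj : Function.Injective (Algebra.TensorProduct.map φ.range.val φ.range.val) :=
    TensorProduct.map_injective_of_flat_flat φ.range.val.toLinearMap φ.range.val.toLinearMap
      Subtype.val_injective Subtype.val_injective
  rw [← hker, ← Algebra.TensorProduct.map_ker _ _ φ.rangeRestrict_surjective
    φ.rangeRestrict_surjective]
  ext x
  rw [RingHom.mem_ker, RingHom.mem_ker, hcomp, AlgHom.comp_apply]
  exact map_eq_zero_iff _ hinj

/-- A polynomial vanishing at the sum of two copies of the generic point of the parametrisation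
`φ` belongs to the second secant ideal of `ker φ`. -/
theorem mem_secantIdeal_two_ker {σ B : Type*} [CommRing B] [Algebra K B]
    (φ : MvPolynomial σ K →ₐ[K] B) (f : MvPolynomial σ K)
    (hf : MvPolynomial.aeval (fun s => φ (MvPolynomial.X s) ⊗ₜ[K] (1 : B) +
      (1 : B) ⊗ₜ[K] φ (MvPolynomial.X s)) f = 0) :
    f ∈ secantIdeal 2 (RingHom.ker φ) := by
  let r : Fin 2 → MvPolynomial σ K →ₐ[K] MvPolynomial (σ ⊕ (Fin 2 × σ)) K :=
    fun a => MvPolynomial.rename fun s : σ => (Sum.inr (a, s) : σ ⊕ (Fin 2 × σ))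
  let Ψ : MvPolynomial σ K ⊗[K] MvPolynomial σ K →ₐ[K] MvPolynomial (σ ⊕ (Fin 2 × σ)) K :=
    Algebra.TensorProduct.productMap (r 0) (r 1)
  let g : MvPolynomial σ K ⊗[K] MvPolynomial σ K := MvPolynomial.aeval
    (fun s => MvPolynomial.X s ⊗ₜ[K] 1 + 1 ⊗ₜ[K] MvPolynomial.X s) f
  have hg : g ∈ RingHom.ker (Algebra.TensorProduct.map φ φ) := by
    rw [RingHom.mem_ker, ← hf]
    change Algebra.TensorProduct.map φ φ (MvPolynomial.aeval _ f) = _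
    rw [← AlgHom.comp_apply, MvPolynomial.comp_aeval]
    simp
  rw [ker_tensorProduct_map] at hg
  unfold secantIdeal
  rw [Ideal.mem_comap]
  set J := (⨆ a : Fin 2, Ideal.map
        (MvPolynomial.rename (fun s : σ => (Sum.inr (a, s) : σ ⊕ (Fin 2 × σ))) :
          MvPolynomial σ K →ₐ[K] MvPolynomial (σ ⊕ (Fin 2 × σ)) K) (RingHom.ker φ)) ⊔
      Ideal.span (Set.range fun s : σ =>
        (∑ a : Fin 2, MvPolynomial.X (Sum.inr (a, s))) - MvPolynomial.X (Sum.inl s))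
  have hr : ∀ a, (RingHom.ker φ).map (r a) ≤ J := fun a =>
    le_trans (le_iSup (fun a => (RingHom.ker φ).map (r a)) a) le_sup_left
  have hΨ : Ψ g ∈ J := by
    refine (Ideal.map_le_iff_le_comap (f := Ψ) (K := J)).1 ?_ hg
    rw [Ideal.map_sup, sup_le_iff]
    constructor
    · rw [Ideal.map_le_iff_le_comap, Ideal.map_le_iff_le_comap]
      intro x hx
      simpa [Ψ] using hr 0 (Ideal.mem_map_of_mem (r 0) hx)
    · rw [Ideal.map_le_iff_le_comap, Ideal.map_le_iff_le_comap]
      intro x hx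
      simpa [Ψ] using hr 1 (Ideal.mem_map_of_mem (r 1) hx)
  -- Modulo `J` each `x_s` equals `y_s + z_s`, so `f` and `Ψ g` have the same class.
  have hcongr : (Ideal.Quotient.mkₐ K J).comp (MvPolynomial.rename Sum.inl) =
      (Ideal.Quotient.mkₐ K J).comp (Ψ.comp (MvPolynomial.aeval
        (fun s => MvPolynomial.X s ⊗ₜ[K] 1 + 1 ⊗ₜ[K] MvPolynomial.X s))) := by
    ext s
    simp only [AlgHom.comp_apply, MvPolynomial.rename_X, MvPolynomial.aeval_X,
      Ideal.Quotient.mkₐ_eq_mk]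
    symm
    rw [Ideal.Quotient.eq]
    refine Ideal.mem_sup_right (Ideal.subset_span ⟨s, ?_⟩)
    simp [Ψ, r, Fin.sum_univ_two]
  have := DFunLike.congr_fun hcongr f
  simp only [AlgHom.comp_apply, Ideal.Quotient.mkₐ_eq_mk] at this
  rw [← Ideal.Quotient.eq_zero_iff_mem] at hΨ ⊢
  exact this.trans hΨ

end Secant

/-! ### Index arithmetic modulo `2k + 1` -/

/-- As `shift k` is `k - 1`, the left side is the modulus. The later index computations rest on this
relation. -/
theorem two_shift_add_three (k : ℕ) : 2 * shift k + 3 = 0 := by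
  have h : (Fin.ofNat (2 * k + 1) k + Fin.ofNat (2 * k + 1) k + 1 : Fin (2 * k + 1)) = 0 := by
    have h1 : ((2 * k + 1 : ℕ) : Fin (2 * k + 1)) = 0 := by simp only [Fin.natCast_self]
    push_cast at h1
    change (k : Fin (2 * k + 1)) + (k : Fin (2 * k + 1)) + 1 = 0
    linear_combination h1
  unfold shift
  linear_combination h

theorem fin_one_ne_zero {k : ℕ} (hk : 1 ≤ k) : (1 : Fin (2 * k + 1)) ≠ 0 := by
  have : Nontrivial (Fin (2 * k + 1)) := Fin.nontrivial_iff_two_le.2 (by omega)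
  exact one_ne_zero

theorem fin_two_ne_zero {k : ℕ} (hk : 1 ≤ k) : (2 : Fin (2 * k + 1)) ≠ 0 := by
  intro h
  apply fin_one_ne_zero hk
  linear_combination two_shift_add_three k - (shift k + 1) * h

theorem eq_one_of_shift_eq_zero {k : ℕ} (hk : 1 ≤ k) (h : shift k = 0) : k = 1 := by
  have h1 : Fin.ofNat (2 * k + 1) k = Fin.ofNat (2 * k + 1) 1 := sub_eq_zero.1 h
  have h2 := congrArg Fin.val h1
  simp only [Fin.ofNat] at h2
  rwa [Nat.mod_eq_of_lt (by omega), Nat.mod_eq_of_lt (by omega)] at h2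

/-- A two-colouring of the cycle of odd length `2k + 1` with steps `k` has an edge whose ends have
the same colour. -/
theorem exists_color_eq {k : ℕ} (c : Fin (2 * k + 1) → Bool) :
    ∃ l, c l = c (l - 1 - shift k) := by
  by_contra! h
  -- If colours always alternate, two steps of `-k` restore the colour, and `-2k = 1`.
  have hstep : ∀ l, c (l + 1) = c l := by
    intro l
    have h1 := h l
    have h2 := h (l - 1 - shift k)
    have h3 : l - 1 - shift k - 1 - shift k = l + 1 := by
      linear_combination -two_shift_add_three k
    rw [h3] at h2
    revert h1 h2
    cases c l <;> cases c (l + 1) <;> cases c (l - 1 - shift k) <;> simp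
  have hconst : ∀ m : ℕ, c (m : Fin (2 * k + 1)) = c 0 := by
    intro m
    induction m with
    | zero => simp
    | succ m ih => rw [Nat.cast_succ, hstep, ih]
  have hall : ∀ l, c l = c 0 := fun l => by
    have := hconst l.val
    rwa [Fin.cast_val_eq_self] at this
  exact h 0 ((hall _).trans (hall _).symm)

/-! ### The monomials of the master polynomial -/

/-- The orbits of a conjugate are the `σ`-images of the original orbits, and these are distinct as
pairs of letters, so the product can be indexed by `l`. -/
theorem involutionMonomial_conj {n k : ℕ} (i j : Fin (2 * k + 1) → Fin n)
    (σ : Equiv.Perm (Letter k)) :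
    involutionMonomial i j (σ * cycleInvolution k * σ⁻¹) =
      ∏ l, edgeVar s(Sum.elim i j (σ (Sum.inl l)), Sum.elim i j (σ (Sum.inr (l + shift k)))) := by
  unfold involutionMonomial
  have himage : Finset.univ.image
      (fun a : Letter k => s(a, (σ * cycleInvolution k * σ⁻¹) a)) =
      Finset.univ.image fun l => s(σ (Sum.inl l), σ (Sum.inr (l + shift k))) := by
    ext e
    simp only [Finset.mem_image, Finset.mem_univ, true_and]
    constructor
    · rintro ⟨a, rfl⟩
      obtain ⟨b, rfl⟩ := σ.surjective a
      rcases b with l | l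
      · exact ⟨l, by simp [cycleInvolution]⟩
      · exact ⟨l - shift k, by simp [cycleInvolution, Sym2.eq_swap]⟩
    · rintro ⟨l, rfl⟩
      exact ⟨σ (Sum.inl l), by simp [cycleInvolution]⟩
  rw [himage, Finset.prod_image]
  · simp
  · intro l _ m _ h
    simpa using h

/-! ### Vanishing on sums of two symmetric matrices of rank one -/

theorem swap_mem_outerGroup {k : ℕ} (l : Fin (2 * k + 1)) :
    Equiv.swap (Sum.inl l) (Sum.inr (l - 1)) ∈ outerGroup k :=
  Subgroup.subset_closure ⟨l, rfl⟩

/-- The alternating sum over the outer group vanishes for a product of letterwise factors that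
depend on a two-colouring of the letters constant on the edges of the cycle. -/
theorem sum_sign_smul_prod_eq_zero {k : ℕ} {R : Type*} [CommRing R] [Fintype (outerGroup k)]
    (u : Bool → Letter k → R) (c : Fin (2 * k + 1) → Bool) :
    ∑ σ : outerGroup k, ((Equiv.Perm.sign (σ : Equiv.Perm (Letter k)) : ℤˣ) : ℤ) •
      ∏ l, (u (c l) ((σ : Equiv.Perm (Letter k)) (Sum.inl l)) *
        u (c l) ((σ : Equiv.Perm (Letter k)) (Sum.inr (l + shift k)))) = 0 := by
  -- A letter inherits the colour of its cycle edge; `j_m` lies on edge `m - shift k`.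
  let C : Letter k → Bool := Sum.elim c fun m => c (m - shift k)
  obtain ⟨l₀, hl₀⟩ := exists_color_eq c
  have hprod : ∀ σ : Equiv.Perm (Letter k),
      ∏ l, (u (c l) (σ (Sum.inl l)) * u (c l) (σ (Sum.inr (l + shift k)))) =
        ∏ a, u (C a) (σ a) := by
    intro σ
    rw [Finset.prod_mul_distrib, Fintype.prod_sum_type]
    congr 1
    refine Fintype.prod_equiv (Equiv.addRight (shift k)) _ _ fun l => ?_
    simp [C]
  simp only [hprod]
  let s : Equiv.Perm (Letter k) := Equiv.swap (Sum.inl l₀) (Sum.inr (l₀ - 1))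
  let S : outerGroup k := ⟨s, swap_mem_outerGroup l₀⟩
  have hs : Equiv.Perm.sign s = -1 := Equiv.Perm.sign_swap (by simp)
  have hC : ∀ a, C (s a) = C a := by
    intro a
    change C (Equiv.swap _ _ a) = C a
    rw [Equiv.swap_apply_def]
    split_ifs with h1 h2
    · subst h1; exact hl₀.symm
    · subst h2; exact hl₀
    · rfl
  -- Right multiplication by the swap permutes letters of equal colour before `σ` acts: the product
  -- is kept and the sign flips.
  refine Finset.sum_involution (fun σ _ => σ * S) ?_ ?_ (by simp) ?_
  · intro σ _
    have hinv : ∏ a, u (C a) (((σ * S : outerGroup k) : Equiv.Perm (Letter k)) a) =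
        ∏ a, u (C a) ((σ : Equiv.Perm (Letter k)) a) := by
      refine Fintype.prod_equiv s _ _ fun a => ?_
      rw [hC]
      rfl
    rw [hinv, Subgroup.coe_mul, map_mul]
    change _ + ((Equiv.Perm.sign (σ : Equiv.Perm (Letter k)) * Equiv.Perm.sign s : ℤˣ) : ℤ) • _ = 0
    simp [hs]
  · intro σ _ _ h
    have h1 : s = 1 := congrArg Subtype.val (mul_eq_left.1 h)
    rw [h1] at hs
    simp at hs
  · intro σ _
    apply Subtype.ext
    ext a
    simp [S, s]

/-! ### Admissible pairs -/

/-- The permutations in the outer group preserve the blocks `{i_l, j_{l-1}}`. -/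
theorem outerGroup_apply_mem {k : ℕ} {σ : Equiv.Perm (Letter k)} (hσ : σ ∈ outerGroup k) :
    (∀ l, σ (Sum.inl l) = Sum.inl l ∨ σ (Sum.inl l) = Sum.inr (l - 1)) ∧
      ∀ l, σ (Sum.inr l) = Sum.inr l ∨ σ (Sum.inr l) = Sum.inl (l + 1) := by
  -- `b` labels the block of a letter; each generator preserves it.
  let b : Letter k → Fin (2 * k + 1) := Sum.elim id (· + 1)
  have hb : ∀ a, b (σ a) = b a := by
    induction hσ using Subgroup.closure_induction with
    | mem x hx =>
      obtain ⟨l, rfl⟩ := hx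
      intro a
      rw [Equiv.swap_apply_def]
      split_ifs with h1 h2
      · subst h1; simp [b]
      · subst h2; simp [b]
      · rfl
    | one => simp
    | mul x y _ _ hx hy => intro a; rw [Equiv.Perm.mul_apply, hx, hy]
    | inv x _ hx => intro a; rw [← hx, ← Equiv.Perm.mul_apply, mul_inv_cancel, Equiv.Perm.one_apply]
  constructor
  · intro l
    have h := hb (Sum.inl l)
    rcases hx : σ (Sum.inl l) with m | m <;> rw [hx] at h <;> simp [b] at h ⊢
    · exact h
    · exact eq_sub_of_add_eq h
  · intro l
    have h := hb (Sum.inr l)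
    rcases hx : σ (Sum.inr l) with m | m <;> rw [hx] at h <;> simp [b] at h ⊢ <;> exact h

namespace Admissible

variable {n k : ℕ} {i j : Fin (2 * k + 1) → Fin n}

theorem i_injective (h : Admissible i j) : Function.Injective i := by
  intro l m hlm
  by_contra hne
  rcases lt_or_gt_of_ne hne with hlt | hlt
  · have h1 := h.le l
    have h2 := h.lt l m hlt
    rw [hlm] at h1
    omega
  · have h1 := h.le m
    have h2 := h.lt m l hlt
    rw [hlm] at h2
    omega

theorem j_injective (h : Admissible i j) : Function.Injective j := by
  intro l m hlm
  by_contra hne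
  rcases lt_or_gt_of_ne hne with hlt | hlt
  · have h1 := h.le m
    have h2 := h.lt l m hlt
    rw [hlm] at h2
    omega
  · have h1 := h.le l
    have h2 := h.lt m l hlt
    rw [hlm] at h1
    omega

theorem eq_of_i_eq_j (h : Admissible i j) {l m : Fin (2 * k + 1)} (hlm : i l = j m) : l = m := by
  by_contra hne
  rcases lt_or_gt_of_ne hne with hlt | hlt
  · have h1 := h.le l
    have h2 := h.lt l m hlt
    have h3 := h.le m
    rw [hlm] at h1
    omega
  · have h2 := h.lt m l hlt
    rw [hlm] at h2
    omega

/-- Letters of different index stand for different vertices. -/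
theorem index_eq (h : Admissible i j) {a b : Letter k}
    (hab : Sum.elim i j a = Sum.elim i j b) : Sum.elim id id a = Sum.elim id id b := by
  rcases a with l | l <;> rcases b with m | m <;> simp only [Sum.elim_inl, Sum.elim_inr] at hab ⊢
  · exact h.i_injective hab
  · exact h.eq_of_i_eq_j hab
  · exact (h.eq_of_i_eq_j hab.symm).symm
  · exact h.j_injective hab

/-- A coincidence forces `shift k = 0`, hence `k = 1`, the case with the extra distinctness
condition. -/
theorem i_ne_j_shift (h : Admissible i j) (l : Fin (2 * k + 1)) : i l ≠ j (l + shift k) := by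
  intro hl
  have h1 := h.eq_of_i_eq_j hl
  have h2 : shift k = 0 := by linear_combination -h1
  rw [h2, add_zero] at hl
  exact h.ne_of_eq_one (eq_one_of_shift_eq_zero h.one_le h2) l hl

/-- The two indices differ by `k - 1`, `k` or `k + 1`; only the first can vanish modulo `2k + 1`.
Hence the default value of `edgeVar` never occurs. -/
theorem vertex_ne (h : Admissible i j) {σ : Equiv.Perm (Letter k)} (hσ : σ ∈ outerGroup k)
    (l : Fin (2 * k + 1)) :
    Sum.elim i j (σ (Sum.inl l)) ≠ Sum.elim i j (σ (Sum.inr (l + shift k))) := by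
  obtain ⟨h1, h2⟩ := outerGroup_apply_mem hσ
  have hone := fin_one_ne_zero h.one_le
  have hs := two_shift_add_three k
  intro he
  have hi := h.index_eq he
  rcases h1 l with ha | ha <;> rcases h2 (l + shift k) with hb | hb <;> rw [ha, hb] at he hi <;>
    simp only [Sum.elim_inl, Sum.elim_inr, id] at he hi
  · exact h.i_ne_j_shift l he
  · exact hone (by linear_combination hs + 2 * hi)
  · exact hone (by linear_combination hs + 2 * hi)
  · exact hone (by linear_combination -hs - 2 * hi)

/-- The edges `i_m j_{m+k-1}` occur in the conjugates of the cycle only as images of themselves. -/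
theorem fixed_of_edge_eq (h : Admissible i j) {σ : Equiv.Perm (Letter k)}
    (hσ : σ ∈ outerGroup k) (l m : Fin (2 * k + 1))
    (he : s(Sum.elim i j (σ (Sum.inl l)), Sum.elim i j (σ (Sum.inr (l + shift k)))) =
      s(i m, j (m + shift k))) :
    σ (Sum.inl l) = Sum.inl l ∧ σ (Sum.inr (l + shift k)) = Sum.inr (l + shift k) := by
  obtain ⟨h1, h2⟩ := outerGroup_apply_mem hσ
  have hone := fin_one_ne_zero h.one_le
  have htwo := fin_two_ne_zero h.one_le
  have hs := two_shift_add_three k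
  -- The target edge has index difference `±(k - 1)`, while moving one or both ends gives `k` or `k
  -- + 1`; equality would force `1 = 0` or `2 = 0`.
  have hidx : (Sum.elim id id (σ (Sum.inl l)) = m ∧
      Sum.elim id id (σ (Sum.inr (l + shift k))) = m + shift k) ∨
      (Sum.elim id id (σ (Sum.inl l)) = m + shift k ∧
        Sum.elim id id (σ (Sum.inr (l + shift k))) = m) := by
    rcases Sym2.eq_iff.1 he with ⟨ha, hb⟩ | ⟨ha, hb⟩
    · exact Or.inl ⟨h.index_eq (b := Sum.inl m) ha, h.index_eq (b := Sum.inr (m + shift k)) hb⟩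
    · exact Or.inr ⟨h.index_eq (b := Sum.inr (m + shift k)) ha, h.index_eq (b := Sum.inl m) hb⟩
  rcases h1 l with ha | ha <;> rcases h2 (l + shift k) with hb | hb <;>
    simp only [ha, hb, Sum.elim_inl, Sum.elim_inr, id] at hidx ⊢
  · simp
  · exfalso
    rcases hidx with ⟨p, q⟩ | ⟨p, q⟩
    · exact hone (by linear_combination q - p)
    · exact htwo (by linear_combination hs - q + p)
  · exfalso
    rcases hidx with ⟨p, q⟩ | ⟨p, q⟩
    · exact hone (by linear_combination q - p)
    · exact htwo (by linear_combination hs - q + p)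
  · exfalso
    rcases hidx with ⟨p, q⟩ | ⟨p, q⟩
    · exact htwo (by linear_combination q - p)
    · exact hone (by linear_combination hs - q + p)

/-! ### The master polynomial is nonzero -/

open Classical in
theorem masterPolynomial_ne_zero (h : Admissible i j) : masterPolynomial i j ≠ 0 := by
  let E : Set (Sym2 (Fin n)) := Set.range fun m => s(i m, j (m + shift k))
  let ev : MvPolynomial (Edge n) ℂ →ₐ[ℂ] ℂ :=
    MvPolynomial.aeval fun e : Edge n => if e.1 ∈ E then 1 else 0
  have hev : ∀ a b : Fin n, a ≠ b → ev (edgeVar s(a, b)) = if s(a, b) ∈ E then 1 else 0 := by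
    intro a b hab
    simp [edgeVar, ev, hab]
  intro h0
  have h1 := congrArg ev h0
  unfold masterPolynomial at h1
  rw [map_sum, map_zero, Finset.sum_eq_single 1] at h1
  · rw [involutionMonomial_conj, map_zsmul, map_prod, Finset.prod_eq_one] at h1
    · simp at h1
    · intro l _
      refine (hev _ _ (h.vertex_ne (one_mem _) l)).trans (if_pos ?_)
      exact ⟨l, by simp⟩
  · intro σ _ hσ
    rw [involutionMonomial_conj, map_zsmul, map_prod]
    by_cases hE : ∀ l, s(Sum.elim i j ((σ : Equiv.Perm (Letter k)) (Sum.inl l)),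
        Sum.elim i j ((σ : Equiv.Perm (Letter k)) (Sum.inr (l + shift k)))) ∈ E
    · refine absurd (Subtype.ext (Equiv.ext ?_)) hσ
      rintro (l | l)
      · obtain ⟨m, hm⟩ := hE l
        exact (h.fixed_of_edge_eq σ.2 l m hm.symm).1
      · obtain ⟨m, hm⟩ := hE (l - shift k)
        simpa using (h.fixed_of_edge_eq σ.2 _ m hm.symm).2
    · push Not at hE
      obtain ⟨l, hl⟩ := hE
      rw [Finset.prod_eq_zero (Finset.mem_univ l), smul_zero]
      rw [hev _ _ (h.vertex_ne σ.2 l), if_neg hl]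
  · simp

/-! ### The master polynomial lies in the secant ideal -/

open Classical in
theorem masterPolynomial_mem_secantIdeal (h : Admissible i j) :
    masterPolynomial i j ∈ secantIdeal 2 (toricIdeal n) := by
  apply mem_secantIdeal_two_ker
  let B := MvPolynomial (Fin n) ℂ
  let u : Bool → Fin n → B ⊗[ℂ] B := fun c a =>
    cond c (MvPolynomial.X a ⊗ₜ[ℂ] 1) (1 ⊗ₜ[ℂ] MvPolynomial.X a)
  let ev : MvPolynomial (Edge n) ℂ →ₐ[ℂ] B ⊗[ℂ] B := MvPolynomial.aeval fun e =>
    phi n (MvPolynomial.X e) ⊗ₜ[ℂ] (1 : B) + (1 : B) ⊗ₜ[ℂ] phi n (MvPolynomial.X e)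
  have hev : ∀ a b : Fin n, a ≠ b → ev (edgeVar s(a, b)) = ∑ c, u c a * u c b := by
    intro a b hab
    simp [edgeVar, ev, hab, u, phi]
  change ev (masterPolynomial i j) = 0
  unfold masterPolynomial
  rw [map_sum]
  have hterm : ∀ σ : outerGroup k,
      ev (((Equiv.Perm.sign (σ : Equiv.Perm (Letter k)) : ℤˣ) : ℤ) • involutionMonomial i j
        (σ * cycleInvolution k * (σ : Equiv.Perm (Letter k))⁻¹)) =
      ∑ c : Fin (2 * k + 1) → Bool, ((Equiv.Perm.sign (σ : Equiv.Perm (Letter k)) : ℤˣ) : ℤ) •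
        ∏ l, (u (c l) (Sum.elim i j ((σ : Equiv.Perm (Letter k)) (Sum.inl l))) *
          u (c l) (Sum.elim i j ((σ : Equiv.Perm (Letter k)) (Sum.inr (l + shift k))))) := by
    intro σ
    rw [involutionMonomial_conj, map_zsmul, map_prod, ← Finset.smul_sum]
    congr 1
    -- Distributing the product over the two summands produces the sum over colourings.
    rw [← Fintype.piFinset_univ, ← Finset.prod_univ_sum (fun _ => Finset.univ) fun l c =>
      u c (Sum.elim i j ((σ : Equiv.Perm (Letter k)) (Sum.inl l))) *
        u c (Sum.elim i j ((σ : Equiv.Perm (Letter k)) (Sum.inr (l + shift k))))]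
    exact Finset.prod_congr rfl fun l _ => hev _ _ (h.vertex_ne σ.2 l)
  simp only [hterm]
  rw [Finset.sum_comm]
  exact Finset.sum_eq_zero fun c _ =>
    sum_sign_smul_prod_eq_zero (fun b a => u b (Sum.elim i j a)) c

end Admissible

end Hypersimplex

theorem mainTheorem4 (n k : ℕ) (i j : Fin (2 * k + 1) → Fin n)
    (hij : Hypersimplex.Admissible i j) :
    Hypersimplex.masterPolynomial i j ≠ 0 ∧
      Hypersimplex.masterPolynomial i j ∈
        Hypersimplex.secantIdeal 2 (Hypersimplex.toricIdeal n) :=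
  ⟨hij.masterPolynomial_ne_zero, hij.masterPolynomial_mem_secantIdeal⟩
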